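/- Let $\Gamma$ be a strongly regular graph with parameters $(v,k,\lambda,\mu)$: it has $v$ vertices, is regular of degree $k$, any two adjacent vertices have exactly $\lambda$ common neighbours, and any two distinct non-adjacent vertices have exactly $\mu$ common neighbours. Suppose that the eigenvalues of its adjacency matrix are exactly $k$, $e^+$ and $e^-$, where $k\ge e^+\ge 0>e^-$. A Delsarte coclique of $\Gamma$ is an independent set $Y$ of vertices with $|Y|=\dfrac{v e^-}{e^--k}$. Let $q>1$ be an odd integer and suppose that $$v=(q+1)(q^2-q+1),\qquad e^+=\frac{q-1}{2},\qquad e^-=-\frac{q^2+1}{2}.$$ Then $\Gamma$ has no Delsarte coclique if one of the following holds: (a) $q\equiv 5 \pmod 8$; (b) $q=2\ell p^{e}+1$ for some prime $p\equiv 3\pmod 4$, some odd positive integer $e$, and some odd positive integer $\ell$ with $\gcd(\ell,p)=1$. Furthermore, if $q>3$, then $\Gamma$ has at most two Delsarte cocliques. -/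

import Mathlib

namespace SimpleGraph

/-- `G` is strongly regular with parameters `(v, k, l, m)`, and the eigenvalues of its adjacency
matrix are exactly `k`, `ePos` and `eNeg`, where `k ≥ ePos ≥ 0 > eNeg`. -/
structure IsSRGWithEigenvalues {V : Type*} [Fintype V] [DecidableEq V] (G : SimpleGraph V)
    [DecidableRel G.Adj] (v k l m : ℕ) (ePos eNeg : ℝ) : Prop where
  isSRGWith : G.IsSRGWith v k l m
  spectrum_eq : spectrum ℝ (G.adjMatrix ℝ) = {(k : ℝ), ePos, eNeg}
  ePos_le : ePos ≤ (k : ℝ)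
  ePos_nonneg : 0 ≤ ePos
  eNeg_neg : eNeg < 0

/-- For a strongly regular graph `G` on `v` vertices, of degree `k` and with negative eigenvalue
`eNeg`, a Delsarte coclique is an independent set `Y` of vertices that attains Hoffman's ratio
bound, `|Y| = v * eNeg / (eNeg - k)`. -/
def IsDelsarteCoclique {V : Type*} (G : SimpleGraph V) (v k : ℕ) (eNeg : ℝ) (Y : Finset V) :
    Prop :=
  G.IsIndepSet (Y : Set V) ∧ (Y.card : ℝ) = (v : ℝ) * eNeg / (eNeg - (k : ℝ))

end SimpleGraph

section

open Matrix Finset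

/-! ### Eigenvalues and parameters of strongly regular graphs -/

namespace SimpleGraph

/-! Let `S` be the Seidel matrix and `T = S + qI`. The given eigenvalues force `T² = (q² + q)T` and
leave two possible degrees `k`. The Schur complement of the block of `T` on a coclique `Y` therefore
has a squared norm linear in `|Y|`. For one degree a Delsarte coclique would make it negative. For
the other, `|Y| = q² - q + 1` makes it zero, so `T` is determined by its rows in `Y`, and the signs
between `Y` and its complement form a design (`IsTightCoclique`). Counting between two such sets
gives `|Y ∩ Y'|(q + 1) = (q - 1)²`, so `q + 1 ∣ 4`; for `q > 3` there is thus even at most one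
Delsarte coclique.

For nonexistence, the design yields a code `E` on `Y`, over `ZMod (p ^ e)` in case (b) and over
`ZMod 2` in case (a), totally singular for a quadratic character `γ` and satisfying `E^⊥ = E ⊕ Rj`.
Summing `∏ γ (x i)` over all words, by factoring and by averaging over `E`, gives `g ^ |Y| = |E| *
g` for the Gauss sum `g = ∑ γ`. Hence `g ^ (|Y| - 1)` is positive. But in (b) `g` is purely
imaginary and `|Y| - 1 = q(q - 1)` is twice an odd number, and in (a) `g = 1 + i` and `|Y| - 1` is
four times an odd number; both powers are negative. -/

theorem sum_adjMatrix_of_regular {V : Type*} [Fintype V] {G : SimpleGraph V}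
    [DecidableRel G.Adj] {k : ℕ} (h : G.IsRegularOfDegree k) (u : V) :
    ∑ w, G.adjMatrix ℝ u w = k := by
  have := G.adjMatrix_mulVec_const_apply_of_regular (α := ℝ) (a := 1) h (v := u)
  simpa [Matrix.mulVec, dotProduct] using this

variable {V : Type*} [Fintype V] [DecidableEq V] {G : SimpleGraph V} [DecidableRel G.Adj]

theorem exists_eigenvector_of_mem_spectrum {M : Matrix V V ℝ} {e : ℝ} (he : e ∈ spectrum ℝ M) :
    Module.End.HasEigenvalue (Matrix.toLin' M) e ∧ ∃ x : V → ℝ, x ≠ 0 ∧ M *ᵥ x = e • x := by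
  rw [← Matrix.spectrum_toLin', ← Module.End.hasEigenvalue_iff_mem_spectrum] at he
  obtain ⟨x, hx⟩ := he.exists_hasEigenvector
  exact ⟨he, x, hx.2, by simpa using hx.apply_eq_smul⟩

/-- Gershgorin discs. Applied to `eNeg`, this separates `ePos` from `k` as soon as `ePos < -eNeg`.
-/
theorem abs_le_degree_of_mem_spectrum {k : ℕ} (h : G.IsRegularOfDegree k) {e : ℝ}
    (he : e ∈ spectrum ℝ (G.adjMatrix ℝ)) : |e| ≤ k := by
  obtain ⟨u, hu⟩ := eigenvalue_mem_ball (exists_eigenvector_of_mem_spectrum he).1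
  have h1 : ∑ j ∈ univ.erase u, ‖G.adjMatrix ℝ u j‖ ≤ ∑ j, G.adjMatrix ℝ u j := by
    rw [← Finset.sum_erase (s := univ) (a := u) (by simp)]
    refine Finset.sum_le_sum fun j _ => ?_
    rw [adjMatrix_apply]; split_ifs <;> simp
  rw [sum_adjMatrix_of_regular h] at h1
  rw [Metric.mem_closedBall, Real.dist_eq] at hu
  simp only [adjMatrix_apply, SimpleGraph.irrefl, if_false, sub_zero] at hu h1
  linarith

theorem IsSRGWith.sum_adjMatrix_mul {v k l m : ℕ} (h : G.IsSRGWith v k l m) (u w : V) :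
    ∑ x, G.adjMatrix ℝ u x * G.adjMatrix ℝ x w =
      m + ((l : ℝ) - m) * G.adjMatrix ℝ u w + ((k : ℝ) - m) * (if u = w then 1 else 0) := by
  have h1 := congrFun (congrFun (h.matrix_eq (α := ℝ)) u) w
  rw [pow_two, Matrix.mul_apply] at h1
  rw [h1]
  simp only [Matrix.add_apply, Matrix.smul_apply, Matrix.one_apply, adjMatrix_apply, compl_adj]
  by_cases huw : u = w
  · subst huw; simp
  · by_cases ha : G.Adj u w <;> simp [huw, ha]

/-- By regularity an eigenvector for `e ≠ k` is orthogonal to the all-ones vector, so the constant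
term of the formula for `A²` disappears on it. -/
theorem IsSRGWith.eigenvalue_quadratic {v k l m : ℕ} (h : G.IsSRGWith v k l m) {e : ℝ}
    (he : e ∈ spectrum ℝ (G.adjMatrix ℝ)) (hek : e ≠ k) :
    e ^ 2 = ((l : ℝ) - m) * e + ((k : ℝ) - m) := by
  obtain ⟨-, x, hx0, hx⟩ := exists_eigenvector_of_mem_spectrum he
  have hx' : ∀ u, ∑ w, G.adjMatrix ℝ u w * x w = e * x u := fun u => by
    simpa [Matrix.mulVec, dotProduct] using congrFun hx u
  have hsum : ∑ u, x u = 0 := by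
    have h1 : ∑ u, ∑ w, G.adjMatrix ℝ u w * x w = e * ∑ u, x u := by
      rw [Finset.mul_sum]; exact Finset.sum_congr rfl fun u _ => hx' u
    rw [Finset.sum_comm] at h1
    have h2 : ∑ w, ∑ u, G.adjMatrix ℝ u w * x w = k * ∑ u, x u := by
      rw [Finset.mul_sum]
      refine Finset.sum_congr rfl fun w _ => ?_
      rw [← Finset.sum_mul]
      congr 1
      rw [← sum_adjMatrix_of_regular h.regular w]
      exact Finset.sum_congr rfl fun u _ => by simp [adjMatrix_apply, G.adj_comm]
    have : (e - k) * ∑ u, x u = 0 := by linarith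
    exact (mul_eq_zero.mp this).resolve_left (sub_ne_zero.mpr hek)
  obtain ⟨u, hu⟩ := Function.ne_iff.mp hx0
  have h3 : ∑ w, (∑ y, G.adjMatrix ℝ u y * G.adjMatrix ℝ y w) * x w = e ^ 2 * x u := by
    have : ∀ w, (∑ y, G.adjMatrix ℝ u y * G.adjMatrix ℝ y w) * x w =
        ∑ y, G.adjMatrix ℝ u y * (G.adjMatrix ℝ y w * x w) := fun w => by
      rw [Finset.sum_mul]; exact Finset.sum_congr rfl fun y _ => by ring
    simp_rw [this]
    rw [Finset.sum_comm]
    simp_rw [← Finset.mul_sum, hx']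
    rw [show e ^ 2 * x u = e * (e * x u) by ring, ← hx' u, Finset.mul_sum]
    exact Finset.sum_congr rfl fun y _ => by ring
  have h4 : ∑ w, (∑ y, G.adjMatrix ℝ u y * G.adjMatrix ℝ y w) * x w =
      (((l : ℝ) - m) * e + ((k : ℝ) - m)) * x u := by
    simp_rw [h.sum_adjMatrix_mul]
    have : ∀ w, ((m : ℝ) + ((l : ℝ) - m) * G.adjMatrix ℝ u w +
        ((k : ℝ) - m) * (if u = w then 1 else 0)) * x w =
        m * x w + ((l : ℝ) - m) * (G.adjMatrix ℝ u w * x w) +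
          ((k : ℝ) - m) * (if u = w then x w else 0) := fun w => by
      split_ifs <;> ring
    simp_rw [this]
    rw [Finset.sum_add_distrib, Finset.sum_add_distrib, ← Finset.mul_sum, ← Finset.mul_sum,
      ← Finset.mul_sum, hsum, hx']
    simp
    ring
  exact mul_right_cancel₀ hu (h3.symm.trans h4)

/-- The parameters of a strongly regular graph in terms of its eigenvalues. -/
theorem IsSRGWithEigenvalues.parameters {v k l m : ℕ} {ePos eNeg : ℝ}
    (h : G.IsSRGWithEigenvalues v k l m ePos eNeg) (hlt : ePos < -eNeg) (hv : 0 < v) :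
    (l : ℝ) - m = ePos + eNeg ∧ (k : ℝ) - m = -(ePos * eNeg) ∧
      (k - ePos) * (k - eNeg) = v * m := by
  have hmemP : ePos ∈ spectrum ℝ (G.adjMatrix ℝ) := by rw [h.spectrum_eq]; simp
  have hmemN : eNeg ∈ spectrum ℝ (G.adjMatrix ℝ) := by rw [h.spectrum_eq]; simp
  have hk := abs_le_degree_of_mem_spectrum h.isSRGWith.regular hmemN
  rw [abs_of_neg h.eNeg_neg] at hk
  have hP := h.isSRGWith.eigenvalue_quadratic hmemP (by linarith)
  have hN := h.isSRGWith.eigenvalue_quadratic hmemN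
    (by have := h.eNeg_neg; have : (0 : ℝ) ≤ k := k.cast_nonneg; linarith)
  have hne : ePos - eNeg ≠ 0 := by have := h.eNeg_neg; have := h.ePos_nonneg; linarith
  have h1 : (l : ℝ) - m = ePos + eNeg := by
    apply mul_left_cancel₀ hne
    linear_combination hN - hP
  have h2 : (k : ℝ) - m = -(ePos * eNeg) := by
    rw [h1] at hP; linear_combination -hP
  refine ⟨h1, h2, ?_⟩
  have : Nonempty V := Fintype.card_pos_iff.mp (by rw [h.isSRGWith.card]; exact hv)
  obtain ⟨u⟩ := this
  -- There are `k²` walks of length two from `u`; counting them by endpoint gives the last relation.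
  have h3 : ∑ w, ∑ x, G.adjMatrix ℝ u x * G.adjMatrix ℝ x w = k * k := by
    rw [Finset.sum_comm]
    simp_rw [← Finset.mul_sum, sum_adjMatrix_of_regular h.isSRGWith.regular]
    rw [← Finset.sum_mul, sum_adjMatrix_of_regular h.isSRGWith.regular]
  simp_rw [h.isSRGWith.sum_adjMatrix_mul] at h3
  rw [Finset.sum_add_distrib, Finset.sum_add_distrib, ← Finset.mul_sum, ← Finset.mul_sum,
    sum_adjMatrix_of_regular h.isSRGWith.regular, h1, h2] at h3
  simp [h.isSRGWith.card] at h3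
  linear_combination -h3

end SimpleGraph

/-! ### The Seidel matrix and its Schur complement on a coclique -/

/-- If `T² = cT` for a symmetric real matrix `T`, then the Schur complement `D` of a nonsingular
principal submatrix satisfies `D² = cD`; this computes its squared Frobenius norm. -/
theorem Matrix.trace_schur_sq {V ι : Type*} [Fintype V] [Fintype ι] [DecidableEq ι]
    {c : ℝ} {T : Matrix V V ℝ} {X : Matrix V ι ℝ} {M K : Matrix ι ι ℝ}
    (hT : Tᵀ = T) (hTT : T * T = c • T) (hTX : T * X = c • X) (hXX : Xᵀ * X = c • M)
    (hMK : M * K = 1) (hK : Kᵀ = K) :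
    trace ((T - X * K * Xᵀ)ᵀ * (T - X * K * Xᵀ)) = c * (trace T - c * Fintype.card ι) := by
  have hXT : Xᵀ * T = c • Xᵀ := by
    have := congrArg Matrix.transpose hTX
    rwa [Matrix.transpose_mul, hT, Matrix.transpose_smul] at this
  have hsymm : (T - X * K * Xᵀ)ᵀ = T - X * K * Xᵀ := by
    rw [Matrix.transpose_sub, Matrix.transpose_mul, Matrix.transpose_mul, hT, hK,
      Matrix.transpose_transpose, Matrix.mul_assoc]
  have h1 : T * (X * K * Xᵀ) = c • (X * K * Xᵀ) := by
    rw [← Matrix.mul_assoc, ← Matrix.mul_assoc, hTX]; simp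
  have h2 : X * K * Xᵀ * T = c • (X * K * Xᵀ) := by
    rw [Matrix.mul_assoc, hXT]; simp
  have h3 : X * K * Xᵀ * (X * K * Xᵀ) = c • (X * K * Xᵀ) := by
    have : X * K * Xᵀ * (X * K * Xᵀ) = X * K * ((Xᵀ * X) * K) * Xᵀ := by
      simp only [Matrix.mul_assoc]
    rw [this, hXX, Matrix.smul_mul, hMK]; simp
  have hDD : (T - X * K * Xᵀ) * (T - X * K * Xᵀ) = c • (T - X * K * Xᵀ) := by
    rw [Matrix.sub_mul, Matrix.mul_sub, Matrix.mul_sub, hTT, h1, h2, h3, smul_sub]; simp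
  have htr : trace (X * K * Xᵀ) = c * Fintype.card ι := by
    rw [Matrix.trace_mul_comm, ← Matrix.mul_assoc, hXX, Matrix.smul_mul, hMK, Matrix.trace_smul,
      Matrix.trace_one, smul_eq_mul]
  rw [hsymm, hDD, Matrix.trace_smul, Matrix.trace_sub, htr, smul_eq_mul]

namespace SimpleGraph

variable {V : Type*} {G : SimpleGraph V} [DecidableRel G.Adj]

/-- The off-diagonal entries of the Seidel matrix, with `1` on the diagonal. -/
def seidelSign (G : SimpleGraph V) [DecidableRel G.Adj] (u w : V) : ℤ :=
  if G.Adj u w then -1 else 1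

theorem seidelSign_comm (u w : V) : G.seidelSign u w = G.seidelSign w u := by
  simp [seidelSign, G.adj_comm]

theorem seidelSign_mul_self (u w : V) : G.seidelSign u w * G.seidelSign u w = 1 := by
  unfold seidelSign; split_ifs <;> simp

theorem seidelSign_eq_one {Y : Finset V} (hY : G.IsIndepSet (Y : Set V)) {u w : V} (hu : u ∈ Y)
    (hw : w ∈ Y) : G.seidelSign u w = 1 := by
  by_cases h : u = w
  · simp [seidelSign, h]
  · simp [seidelSign, hY (by simpa using hu) (by simpa using hw) h]

theorem sum_seidelSign [Fintype V] {k : ℕ} (h : G.IsRegularOfDegree k) (u : V) :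
    ∑ w, (G.seidelSign u w : ℝ) = Fintype.card V - 2 * k := by
  have : ∀ w, (G.seidelSign u w : ℝ) = 1 - 2 * G.adjMatrix ℝ u w := fun w => by
    rw [seidelSign, adjMatrix_apply]
    by_cases h : G.Adj u w <;> simp [h]
    norm_num
  simp_rw [this]
  rw [Finset.sum_sub_distrib, ← Finset.mul_sum, sum_adjMatrix_of_regular h]
  simp

variable [DecidableEq V]

/-- The matrix `S + qI`, where `S` is the Seidel matrix of `G`. -/
def shiftedSeidel (G : SimpleGraph V) [DecidableRel G.Adj] (q : ℝ) : Matrix V V ℝ :=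
  Matrix.of fun u w => (G.seidelSign u w : ℝ) + (q - 1) * (if u = w then 1 else 0)

theorem shiftedSeidel_apply (q : ℝ) (u w : V) : G.shiftedSeidel q u w =
    (G.seidelSign u w : ℝ) + (q - 1) * (if u = w then 1 else 0) := rfl

theorem shiftedSeidel_transpose (q : ℝ) : (G.shiftedSeidel q)ᵀ = G.shiftedSeidel q := by
  ext u w
  simp [shiftedSeidel_apply, seidelSign_comm w u, eq_comm]

theorem shiftedSeidel_eq (q : ℝ) (u w : V) : G.shiftedSeidel q u w =
    1 - 2 * G.adjMatrix ℝ u w + (q - 1) * (if u = w then 1 else 0) := by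
  rw [shiftedSeidel_apply, seidelSign, adjMatrix_apply]
  by_cases h : G.Adj u w <;> simp [h]
  norm_num

variable [Fintype V]

/-- The Seidel matrix of a graph with the given eigenvalues has only two eigenvalues. -/
theorem IsSRGWithEigenvalues.shiftedSeidel_mul_self {v k l m : ℕ} {ePos eNeg q : ℝ}
    (h : G.IsSRGWithEigenvalues v k l m ePos eNeg) (hq : 1 < q)
    (hv : (v : ℝ) = (q + 1) * (q ^ 2 - q + 1)) (hePos : ePos = (q - 1) / 2)
    (heNeg : eNeg = -((q ^ 2 + 1) / 2)) :
    G.shiftedSeidel q * G.shiftedSeidel q = (q ^ 2 + q) • G.shiftedSeidel q ∧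
      ((k : ℝ) = q ^ 2 * (q - 1) / 2 ∨ (k : ℝ) = q * (q ^ 2 + 1) / 2) := by
  have hv0 : 0 < v := by
    have : (0 : ℝ) < v := by rw [hv]; nlinarith
    exact_mod_cast this
  obtain ⟨h1, h2, h3⟩ := h.parameters (by rw [hePos, heNeg]; nlinarith) hv0
  have hm : (m : ℝ) = k + ePos * eNeg := by linarith
  constructor
  · ext u w
    rw [Matrix.mul_apply, Matrix.smul_apply, smul_eq_mul]
    have e1 : ∀ x, G.shiftedSeidel q u x * G.shiftedSeidel q x w =
        1 - 2 * G.adjMatrix ℝ w x - 2 * G.adjMatrix ℝ u x +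
        4 * (G.adjMatrix ℝ u x * G.adjMatrix ℝ x w) +
        (if u = x then (q - 1) * G.shiftedSeidel q x w else 0) +
        (if x = w then (q - 1) * (1 - 2 * G.adjMatrix ℝ u x) else 0) := by
      intro x
      have : G.adjMatrix ℝ w x = G.adjMatrix ℝ x w := by simp [adjMatrix_apply, G.adj_comm]
      rw [this, shiftedSeidel_eq, shiftedSeidel_eq]
      split_ifs <;> ring
    simp_rw [e1]
    simp only [Finset.sum_add_distrib, Finset.sum_sub_distrib, ← Finset.mul_sum,
      sum_adjMatrix_of_regular h.isSRGWith.regular, h.isSRGWith.sum_adjMatrix_mul,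
      Finset.sum_ite_eq, Finset.sum_ite_eq', Finset.mem_univ, if_true, h1, h2]
    simp only [Finset.sum_const, Finset.card_univ, h.isSRGWith.card, nsmul_eq_mul, hv, hm, hePos,
      heNeg, shiftedSeidel_eq]
    ring
  · rw [hm, hePos, heNeg, hv] at h3
    -- Eliminating `m` leaves a monic quadratic in `k` with these roots.
    have : ((k : ℝ) - q ^ 2 * (q - 1) / 2) * (k - q * (q ^ 2 + 1) / 2) = 0 := by
      linear_combination h3
    rcases mul_eq_zero.mp this with h | h
    · left; linarith
    · right; linarith

/-- The rank-`|Y|` approximation to `S + qI` determined by the rows of a coclique `Y`. -/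
noncomputable def cocliqueSchur (G : SimpleGraph V) [DecidableRel G.Adj] (q : ℝ) (Y : Finset V) (u w : V) : ℝ :=
  G.shiftedSeidel q u w - (∑ y ∈ Y, G.shiftedSeidel q u y * G.shiftedSeidel q w y -
    (∑ y ∈ Y, G.shiftedSeidel q u y) * (∑ y ∈ Y, G.shiftedSeidel q w y) /
      (q - 1 + Y.card)) / (q - 1)

/-- On a coclique the block `M` of `T` is `J + (q - 1)I`, whose inverse `K` is explicit, and
`cocliqueSchur` is `T - X K Xᵀ`. Nonnegativity of the left side is a ratio bound on `|Y|`; equality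
makes every entry vanish. -/
theorem sum_cocliqueSchur_sq {q : ℝ} (hq : 1 < q)
    (hT : G.shiftedSeidel q * G.shiftedSeidel q = (q ^ 2 + q) • G.shiftedSeidel q)
    {Y : Finset V} (hY : G.IsIndepSet (Y : Set V)) :
    ∑ u, ∑ w, G.cocliqueSchur q Y u w ^ 2 =
      (q ^ 2 + q) * (q * Fintype.card V - (q ^ 2 + q) * Y.card) := by
  set T := G.shiftedSeidel q with hTdef
  set X : Matrix V Y ℝ := T.submatrix id Subtype.val with hX
  set M : Matrix Y Y ℝ := T.submatrix Subtype.val Subtype.val with hM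
  have hq1 : q - 1 ≠ 0 := by linarith
  have hN : q - 1 + (Y.card : ℝ) ≠ 0 := by
    have : (0 : ℝ) ≤ Y.card := Nat.cast_nonneg _
    linarith
  set K : Matrix Y Y ℝ := Matrix.of fun a b =>
    ((if a = b then 1 else 0) - 1 / (q - 1 + (Y.card : ℝ))) / (q - 1) with hK
  have hTt : Tᵀ = T := shiftedSeidel_transpose q
  have hTapp : ∀ u w, ∑ x, T u x * T x w = (q ^ 2 + q) * T u w := fun u w => by
    simpa [Matrix.mul_apply] using congrFun (congrFun hT u) w
  have hTX : T * X = (q ^ 2 + q) • X := by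
    ext u y
    simpa [Matrix.mul_apply, hX] using hTapp u y
  have hTs : ∀ u w, T u w = T w u := fun u w => congrFun (congrFun hTt w) u
  have hXX : Xᵀ * X = (q ^ 2 + q) • M := by
    ext a b
    have := hTapp a b
    simp only [hTs a] at this
    simpa [Matrix.mul_apply, hX, hM, hTs a.1 b.1] using this
  have hMapp : ∀ a b : Y, M a b = 1 + (q - 1) * (if a = b then 1 else 0) := fun a b => by
    simp only [hM, hTdef, Matrix.submatrix_apply, shiftedSeidel_apply,
      seidelSign_eq_one hY a.2 b.2, Int.cast_one, Subtype.ext_iff]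
  have hMK : M * K = 1 := by
    ext a b
    rw [Matrix.mul_apply, Matrix.one_apply]
    have e1 : ∀ j, M a j * K j b = (if j = b then 1 else 0) / (q - 1) -
        1 / (q - 1 + (Y.card : ℝ)) / (q - 1) +
        (if a = j then (q - 1) * K j b else 0) := fun j => by
      rw [hMapp, hK, Matrix.of_apply]
      split_ifs <;> ring
    simp_rw [e1]
    rw [Finset.sum_add_distrib, Finset.sum_sub_distrib, ← Finset.sum_div]
    simp only [Finset.sum_ite_eq, Finset.sum_ite_eq', Finset.mem_univ, if_true, Finset.sum_const,
      Finset.card_univ, Fintype.card_coe, nsmul_eq_mul, hK, Matrix.of_apply]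
    field_simp
    ring
  have hKt : Kᵀ = K := by
    ext a b
    simp [hK, eq_comm]
  have key := Matrix.trace_schur_sq hTt hT hTX hXX hMK hKt
  have hD : ∀ u w, (T - X * K * Xᵀ) u w = G.cocliqueSchur q Y u w := by
    intro u w
    rw [Matrix.sub_apply, cocliqueSchur, ← hTdef]
    congr 1
    rw [Matrix.mul_apply]
    have e2 : ∀ j : Y, (X * K) u j * Xᵀ j w =
        (T u j * T w j - (∑ y ∈ Y, T u y) * T w j / (q - 1 + (Y.card : ℝ))) / (q - 1) := by
      intro j
      have e3 : (X * K) u j = (T u j - (∑ y ∈ Y, T u y) / (q - 1 + (Y.card : ℝ))) / (q - 1) := by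
        rw [Matrix.mul_apply, ← Finset.sum_coe_sort Y]
        have : ∀ i, X u i * K i j = ((if i = j then T u i else 0) -
            T u i / (q - 1 + (Y.card : ℝ))) / (q - 1) := fun i => by
          simp only [hX, hK, Matrix.submatrix_apply, Matrix.of_apply, id]
          split_ifs <;> ring
        simp_rw [this]
        rw [← Finset.sum_div, Finset.sum_sub_distrib, ← Finset.sum_div]
        simp
      rw [e3]
      simp only [hX, Matrix.transpose_apply, Matrix.submatrix_apply, id]
      ring
    simp_rw [e2]
    rw [← Finset.sum_div, Finset.sum_sub_distrib, ← Finset.sum_div, ← Finset.mul_sum,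
      Finset.sum_coe_sort Y (fun y => T u y * T w y), Finset.sum_coe_sort Y (fun y => T w y)]
  have htrT : trace T = q * Fintype.card V := by
    simp [Matrix.trace, hTdef, shiftedSeidel_apply, seidelSign, mul_comm]
  rw [htrT, Fintype.card_coe] at key
  rw [← key, Finset.sum_comm]
  simp only [Matrix.trace, Matrix.diag, Matrix.mul_apply, Matrix.transpose_apply, hD, pow_two]

end SimpleGraph

/-! ### Tight cocliques: the design and uniqueness -/

namespace SimpleGraph

variable {V : Type*} [DecidableEq V] [Fintype V] {G : SimpleGraph V} [DecidableRel G.Adj]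

/-- The design carried by a coclique of size `q² - q + 1` in a two-graph on `q³ + 1` vertices. -/
structure IsTightCoclique (G : SimpleGraph V) [DecidableRel G.Adj] (q : ℤ) (Y : Finset V) :
    Prop where
  isIndepSet : G.IsIndepSet (Y : Set V)
  card_eq : (Y.card : ℤ) = q ^ 2 - q + 1
  card_compl : (Yᶜ.card : ℤ) = q * (q ^ 2 - q + 1)
  sum_row : ∀ z ∉ Y, ∑ y ∈ Y, G.seidelSign z y = -q
  sum_row_mul : ∀ z ∉ Y, ∀ w ∉ Y, z ≠ w →
    ∑ y ∈ Y, G.seidelSign z y * G.seidelSign w y = 1 + (q - 1) * G.seidelSign z w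
  sum_col : ∀ y ∈ Y, ∑ z ∈ Yᶜ, G.seidelSign z y = -q ^ 2
  sum_col_mul : ∀ y ∈ Y, ∀ w ∈ Y, ∑ z ∈ Yᶜ, G.seidelSign z y * G.seidelSign z w =
    1 + (if y = w then (q - 1) * (q ^ 2 + 1) else 0)

theorem IsSRGWithEigenvalues.isTightCoclique {v k l m q : ℕ} {ePos eNeg : ℝ}
    (h : G.IsSRGWithEigenvalues v k l m ePos eNeg) (hq : 1 < q)
    (hv : (v : ℝ) = ((q : ℝ) + 1) * ((q : ℝ) ^ 2 - (q : ℝ) + 1))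
    (hePos : ePos = ((q : ℝ) - 1) / 2) (heNeg : eNeg = -(((q : ℝ) ^ 2 + 1) / 2))
    {Y : Finset V} (hY : G.IsDelsarteCoclique v k eNeg Y) : G.IsTightCoclique q Y := by
  obtain ⟨hind, hcard⟩ := hY
  have hq' : (1 : ℝ) < q := by exact_mod_cast hq
  obtain ⟨hT, hk⟩ := h.shiftedSeidel_mul_self hq' hv hePos heNeg
  have hS := sum_cocliqueSchur_sq hq' hT hind
  have hSnn : 0 ≤ ∑ u, ∑ w, G.cocliqueSchur q Y u w ^ 2 :=
    Finset.sum_nonneg fun u _ => Finset.sum_nonneg fun w _ => sq_nonneg _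
  rw [h.isSRGWith.card, hv] at hS
  generalize hr : (q : ℝ) = r at *
  have hr1 : r - 1 ≠ 0 := by linarith
  rcases hk with hk | hk
  -- Here `|Y| = q² + 1` exceeds the ratio bound: the squared norm would be negative.
  · exfalso
    have hc : (Y.card : ℝ) = r ^ 2 + 1 := by
      have h0 : -((r ^ 2 + 1) / 2) - r ^ 2 * (r - 1) / 2 ≠ 0 := by nlinarith [sq_nonneg r]
      rw [hcard, hv, heNeg, hk, div_eq_iff h0]; ring
    rw [hS, hc] at hSnn
    have : 0 < (r ^ 2 + r) * (r ^ 2 * (r + 1)) := by positivity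
    nlinarith
  have hc : (Y.card : ℝ) = r ^ 2 - r + 1 := by
    have h0 : -((r ^ 2 + 1) / 2) - r * (r ^ 2 + 1) / 2 ≠ 0 := by nlinarith [sq_nonneg r]
    rw [hcard, hv, heNeg, hk, div_eq_iff h0]; ring
  have hD : ∀ u w, G.cocliqueSchur r Y u w = 0 := by
    have h0 : ∑ u, ∑ w, G.cocliqueSchur r Y u w ^ 2 = 0 := by rw [hS, hc]; ring
    intro u w
    have h1 := (Finset.sum_eq_zero_iff_of_nonneg
      (fun u _ => Finset.sum_nonneg fun w _ => sq_nonneg _)).mp h0 u (Finset.mem_univ u)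
    have h2 := (Finset.sum_eq_zero_iff_of_nonneg (fun w _ => sq_nonneg _)).mp h1 w
      (Finset.mem_univ w)
    exact pow_eq_zero_iff (two_ne_zero) |>.mp h2
  have hcompl : (Yᶜ.card : ℝ) = r * (r ^ 2 - r + 1) := by
    rw [Finset.card_compl, Nat.cast_sub (Finset.card_le_univ Y), h.isSRGWith.card, hv, hc]; ring
  have hTo : ∀ z ∉ Y, ∀ y ∈ Y, G.shiftedSeidel r z y = G.seidelSign z y := by
    intro z hz y hy
    have : z ≠ y := fun h => hz (h ▸ hy)
    simp [shiftedSeidel_apply, this]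
  have hTi : ∀ z ∈ Y, ∀ y ∈ Y,
      G.shiftedSeidel r z y = 1 + (r - 1) * (if z = y then 1 else 0) := by
    intro z hz y hy
    simp [shiftedSeidel_apply, seidelSign_eq_one hind hz hy]
  have hcol : ∀ y ∈ Y, ∑ z ∈ Yᶜ, (G.seidelSign z y : ℝ) = -r ^ 2 := by
    intro y hy
    have h1 := sum_seidelSign h.isSRGWith.regular y
    rw [← Finset.sum_add_sum_compl Y, Finset.sum_congr rfl (fun w hw => by
      rw [seidelSign_eq_one hind hy hw]), h.isSRGWith.card, hv, hk] at h1
    simp only [seidelSign_comm y] at h1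
    simp only [Int.cast_one, Finset.sum_const, nsmul_eq_mul, mul_one, hc] at h1
    linear_combination h1
  -- A vanishing diagonal entry of the Schur complement fixes the row sum up to sign.
  have hdiag : ∀ z ∉ Y, (∑ y ∈ Y, (G.seidelSign z y : ℝ)) ^ 2 = r ^ 2 := by
    intro z hz
    have h1 := hD z z
    rw [cocliqueSchur, Finset.sum_congr rfl (fun y hy => by rw [hTo z hz y hy]),
      Finset.sum_congr rfl (fun y hy => hTo z hz y hy), shiftedSeidel_apply] at h1
    have h2 : ∀ y, (G.seidelSign z y : ℝ) * G.seidelSign z y = 1 := fun y => by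
      exact_mod_cast seidelSign_mul_self z y
    simp only [h2, Finset.sum_const, nsmul_eq_mul, mul_one, hc] at h1
    have h3 : (G.seidelSign z z : ℝ) = 1 := by simp [seidelSign]
    rw [h3] at h1
    have h4 : r - 1 + (r ^ 2 - r + 1) = r ^ 2 := by ring
    rw [h4] at h1
    have hr0 : r ≠ 0 := by linarith
    simp only [if_true] at h1
    field_simp at h1
    linear_combination h1
  -- Each row sum is `r` or `-r`, and the column sums give their total; it is the minimum possible,
  -- so every sign is negative.
  have hrow : ∀ z ∉ Y, ∑ y ∈ Y, (G.seidelSign z y : ℝ) = -r := by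
    have h1 : ∑ z ∈ Yᶜ, (∑ y ∈ Y, (G.seidelSign z y : ℝ) + r) = 0 := by
      rw [Finset.sum_add_distrib, Finset.sum_comm, Finset.sum_congr rfl hcol]
      simp only [Finset.sum_const, nsmul_eq_mul, hcompl, hc]
      ring
    have h2 := (Finset.sum_eq_zero_iff_of_nonneg (fun z hz => by
      have h3 := hdiag z (by simpa using hz)
      rcases sq_eq_sq_iff_eq_or_eq_neg.mp h3 with h4 | h4 <;> rw [h4] <;> linarith)).mp h1
    intro z hz
    have := h2 z (by simpa using hz)
    linarith
  have hrowmul : ∀ z ∉ Y, ∀ w ∉ Y, z ≠ w →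
      ∑ y ∈ Y, (G.seidelSign z y : ℝ) * G.seidelSign w y = 1 + (r - 1) * G.seidelSign z w := by
    intro z hz w hw hzw
    have h1 := hD z w
    rw [cocliqueSchur, Finset.sum_congr rfl (fun y hy => by rw [hTo z hz y hy, hTo w hw y hy]),
      Finset.sum_congr rfl (fun y hy => hTo z hz y hy), hrow z hz,
      Finset.sum_congr rfl (fun y hy => hTo w hw y hy), hrow w hw, shiftedSeidel_apply, hc] at h1
    have h4 : r - 1 + (r ^ 2 - r + 1) = r ^ 2 := by ring
    have hr0 : r ≠ 0 := by linarith
    rw [h4, if_neg hzw] at h1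
    field_simp at h1
    linear_combination -h1
  -- Read off from the `(y, w)` entry of `T² = (r² + r)T`, after removing the known contribution of
  -- `Y`.
  have hcolmul : ∀ y ∈ Y, ∀ w ∈ Y, ∑ z ∈ Yᶜ, (G.seidelSign z y : ℝ) * G.seidelSign z w =
      1 + (if y = w then (r - 1) * (r ^ 2 + 1) else 0) := by
    intro y hy w hw
    have h1 := congrFun (congrFun hT y) w
    rw [Matrix.mul_apply, Matrix.smul_apply, smul_eq_mul, ← Finset.sum_add_sum_compl Y] at h1
    have h2 : ∑ x ∈ Y, G.shiftedSeidel r y x * G.shiftedSeidel r x w =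
        (r ^ 2 - r + 1) + 2 * (r - 1) + (if y = w then (r - 1) ^ 2 else 0) := by
      rw [Finset.sum_congr rfl (fun x hx => by
        rw [hTi y hy x hx, hTi x hx w hw, show
          (1 + (r - 1) * (if y = x then (1 : ℝ) else 0)) *
            (1 + (r - 1) * (if x = w then (1 : ℝ) else 0)) =
          1 + (if x = w then (r - 1) else 0) + (if y = x then
            (r - 1) * (1 + (r - 1) * (if x = w then (1 : ℝ) else 0)) else 0) by
              split_ifs <;> ring])]
      rw [Finset.sum_add_distrib, Finset.sum_add_distrib]
      simp only [Finset.sum_const, Finset.sum_ite_eq, Finset.sum_ite_eq', hy, hw, if_true,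
        nsmul_eq_mul, hc]
      split_ifs <;> ring
    have h3 : ∑ x ∈ Yᶜ, G.shiftedSeidel r y x * G.shiftedSeidel r x w =
        ∑ z ∈ Yᶜ, (G.seidelSign z y : ℝ) * G.seidelSign z w := by
      refine Finset.sum_congr rfl fun x hx => ?_
      have hx' : x ∉ Y := by simpa using hx
      rw [← hTo x hx' y hy, ← hTo x hx' w hw,
        show G.shiftedSeidel r y x = G.shiftedSeidel r x y from
          congrFun (congrFun (shiftedSeidel_transpose r) x) y]
    rw [h2, h3, hTi y hy w hw] at h1
    split_ifs at h1 ⊢ <;> linear_combination h1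
  subst hr
  refine ⟨hind, ?_, ?_, fun z hz => ?_, fun z hz w hw hzw => ?_, fun y hy => ?_,
    fun y hy w hw => ?_⟩
  · exact_mod_cast hc
  · exact_mod_cast hcompl
  · exact_mod_cast hrow z hz
  · exact_mod_cast hrowmul z hz w hw hzw
  · exact_mod_cast hcol y hy
  · exact_mod_cast hcolmul y hy w hw

/-- Distinct tight cocliques exist only for `q = 3`. -/
theorem IsTightCoclique.eq_of_three_lt {q : ℤ} (hq : 3 < q) {Y Y' : Finset V}
    (hY : G.IsTightCoclique q Y) (hY' : G.IsTightCoclique q Y') : Y = Y' := by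
  by_contra hne
  set I := Y ∩ Y' with hI
  set U := Y \ Y' with hU
  set W := Y' \ Y with hW
  have hcU : (U.card : ℤ) = q ^ 2 - q + 1 - I.card := by
    have := Finset.card_sdiff_add_card_inter Y Y'
    have := hY.card_eq
    rw [← hU, ← hI] at *
    omega
  have hcW : (W.card : ℤ) = q ^ 2 - q + 1 - I.card := by
    have h1 := Finset.card_sdiff_add_card_inter Y' Y
    have := hY'.card_eq
    rw [Finset.inter_comm, ← hW, ← hI] at h1
    omega
  have hpos : W.card ≠ 0 := by
    intro h0
    have hUe : U.card = 0 := by omega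
    rw [Finset.card_eq_zero, Finset.sdiff_eq_empty_iff_subset] at h0 hUe
    exact hne (Finset.Subset.antisymm hUe h0)
  have hUcol : ∀ y ∈ U, ∑ z ∈ W, G.seidelSign z y = -q - I.card := by
    intro y hy
    have hy' := Finset.mem_sdiff.mp hy
    have h1 := hY'.sum_row y hy'.2
    rw [← Finset.sum_inter_add_sum_sdiff Y' Y] at h1
    rw [Finset.sum_congr rfl (fun w hw => seidelSign_eq_one hY.isIndepSet hy'.1
      (Finset.mem_inter.mp hw).2), Finset.inter_comm] at h1
    simp only [seidelSign_comm y, Finset.sum_const, nsmul_eq_mul, mul_one] at h1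
    linarith
  have hWin : ∀ z ∈ W, ∀ w ∈ W, ∑ y ∈ U, G.seidelSign z y * G.seidelSign w y =
      (q - I.card) + (if z = w then q ^ 2 - 2 * q + 1 else 0) := by
    intro z hz w hw
    have hz' := Finset.mem_sdiff.mp hz
    have hw' := Finset.mem_sdiff.mp hw
    have h1 : ∑ y ∈ Y, G.seidelSign z y * G.seidelSign w y =
        q + (if z = w then q ^ 2 - 2 * q + 1 else 0) := by
      split_ifs with h
      · subst h
        simp only [seidelSign_mul_self, Finset.sum_const, nsmul_eq_mul, mul_one, hY.card_eq]
        ring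
      · rw [hY.sum_row_mul z hz'.2 w hw'.2 h, seidelSign_eq_one hY'.isIndepSet hz'.1 hw'.1]
        ring
    rw [← Finset.sum_inter_add_sum_sdiff Y Y', Finset.sum_congr rfl (fun y hy => by
      rw [seidelSign_eq_one hY'.isIndepSet hz'.1 (Finset.mem_inter.mp hy).2,
        seidelSign_eq_one hY'.isIndepSet hw'.1 (Finset.mem_inter.mp hy).2])] at h1
    simp only [Finset.sum_const, nsmul_eq_mul, mul_one] at h1
    linarith
  -- The squared column sums over `U` are expanded into inner products of rows indexed by `W`.
  have hcount : (U.card : ℤ) * (-q - I.card) ^ 2 =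
      W.card * (W.card * (q - I.card) + (q ^ 2 - 2 * q + 1)) := by
    have h1 : ∑ y ∈ U, (∑ z ∈ W, G.seidelSign z y) ^ 2 =
        ∑ z ∈ W, ∑ w ∈ W, ∑ y ∈ U, G.seidelSign z y * G.seidelSign w y := by
      simp_rw [pow_two, Finset.sum_mul_sum]
      rw [Finset.sum_comm]
      exact Finset.sum_congr rfl fun z _ => Finset.sum_comm
    rw [Finset.sum_congr rfl (fun y hy => by rw [hUcol y hy]),
      Finset.sum_congr rfl (fun z hz => Finset.sum_congr rfl (fun w hw => hWin z hz w hw))] at h1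
    simp only [Finset.sum_add_distrib, Finset.sum_const, nsmul_eq_mul, Finset.sum_ite_eq] at h1
    rw [Finset.sum_congr rfl (fun z hz => by rw [if_pos hz])] at h1
    simp only [Finset.sum_const, nsmul_eq_mul] at h1
    linear_combination h1
  have hWU : (U.card : ℤ) = W.card := by rw [hcU, hcW]
  rw [hWU] at hcount
  have h2 := mul_left_cancel₀ (by exact_mod_cast hpos) hcount
  rw [hcW] at h2
  have h3 : (q + 1) * ((I.card : ℤ) * (q + 1) - (q - 1) ^ 2) = 0 := by linear_combination h2
  have h4 := (mul_eq_zero.mp h3).resolve_left (by omega)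
  -- `(q - 1)² ≡ 4` modulo `q + 1`.
  have h5 : q + 1 ∣ 4 := ⟨I.card - q + 3, by linear_combination -h4⟩
  have h6 := Int.le_of_dvd (by norm_num) h5
  omega

end SimpleGraph

/-! ### Character sums and self-orthogonal codes -/

/-- Averaging over a subgroup `E` along which `f` transforms by characters leaves only the points
whose character is trivial. -/
theorem AddChar.sum_eq_sum_filter_trivial {A : Type*} [AddCommGroup A] [Fintype A]
    (E : AddSubgroup A) (f : A → ℂ) (χ : A → AddChar E ℂ)
    (hf : ∀ x, ∀ e : E, f (x + e) = f x * χ x e) [DecidablePred fun x => χ x = 0] :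
    ∑ x, f x = ∑ x with χ x = 0, f x := by
  classical
  have hE : (Fintype.card E : ℂ) ≠ 0 := Nat.cast_ne_zero.mpr Fintype.card_ne_zero
  apply mul_left_cancel₀ hE
  have h1 : (Fintype.card E : ℂ) * ∑ x, f x = ∑ e : E, ∑ x, f (x + e) := by
    have (e : E) : ∑ x, f (x + e) = ∑ x, f x := Equiv.sum_comp (Equiv.addRight (e : A)) f
    simp [this]
  rw [h1, Finset.sum_comm, Finset.sum_filter, Finset.mul_sum]
  refine Finset.sum_congr rfl fun x _ => ?_
  simp_rw [hf]
  rw [← Finset.mul_sum, AddChar.sum_eq_ite]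
  split_ifs <;> simp [mul_comm]

theorem AddMonoidHom.exists_sum_comp_eq {A B : Type*} [AddGroup A] [AddGroup B] [Fintype A]
    [Fintype B] (φ : A →+ B) (hφ : Function.Surjective φ) :
    ∃ N : ℕ, N ≠ 0 ∧ ∀ g : B → ℂ, ∑ a, g (φ a) = N * ∑ b, g b := by
  classical
  refine ⟨#{a | φ a = 0}, Finset.card_ne_zero_of_mem (a := 0) (by simp), fun g => ?_⟩
  rw [← Finset.sum_fiberwise (s := univ) (g := φ), Finset.mul_sum]
  refine Finset.sum_congr rfl fun b _ => ?_
  have h1 : #{a | φ a = 0} = #{a | φ a = b} :=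
    AddMonoidHom.card_fiber_eq_of_mem_range φ ⟨0, map_zero φ⟩ (hφ b)
  rw [h1, Finset.sum_congr rfl (fun a ha => by rw [(Finset.mem_filter.mp ha).2]),
    Finset.sum_const, nsmul_eq_mul]

theorem AddChar.map_sum_eq_prod_apply {A ι : Type*} [AddCommGroup A] (ψ : AddChar A ℂ)
    (s : Finset ι) (f : ι → A) : ψ (∑ i ∈ s, f i) = ∏ i ∈ s, ψ (f i) :=
  map_prod ψ.toMonoidHom (fun i => Multiplicative.ofAdd (f i)) s

/-- A code `E` orthogonal to the all-ones vector `j`, whose orthogonal complement is `E ⊕ Rj` and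
which is totally singular for the quadratic character `γ`, determines a power of a Gauss sum. -/
theorem AddChar.gauss_pow_eq_card_mul {R ι : Type*} [CommRing R] [Fintype R] [Fintype ι]
    (hι : (Fintype.card ι : R) = 1) (γ : R → ℂ) (ψ : AddChar R ℂ)
    (hγ : ∀ s t, γ (s + t) = γ s * γ t * ψ (s * t)) (E : AddSubgroup (ι → R))
    (hE0 : ∀ e ∈ E, ∑ i, e i = 0) (hE1 : ∀ e ∈ E, ∏ i, γ (e i) = 1)
    (hperp : ∀ x : ι → R, (∀ e ∈ E, ψ (∑ i, x i * e i) = 1) → (fun i => x i - ∑ i, x i) ∈ E) :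
    (∑ s, γ s) ^ Fintype.card ι = Nat.card E * ∑ t, γ t ^ Fintype.card ι := by
  classical
  have hadd : ∀ x y : ι → R, ∏ i, γ ((x + y) i) =
      (∏ i, γ (x i)) * (∏ i, γ (y i)) * ψ (∑ i, x i * y i) := fun x y => by
    rw [AddChar.map_sum_eq_prod_apply, ← Finset.prod_mul_distrib, ← Finset.prod_mul_distrib]
    exact Finset.prod_congr rfl fun i _ => hγ _ _
  -- Polarisation: a totally singular code is self-orthogonal.
  have hEE : ∀ x ∈ E, ∀ y ∈ E, ψ (∑ i, x i * y i) = 1 := fun x hx y hy => by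
    have := hadd x y
    rw [hE1 _ (E.add_mem hx hy), hE1 x hx, hE1 y hy] at this
    simpa using this.symm
  let χ : (ι → R) → AddChar E ℂ := fun x =>
    { toFun := fun e => ψ (∑ i, x i * e.1 i)
      map_zero_eq_one' := by simp
      map_add_eq_mul' := fun a b => by
        rw [← AddChar.map_add_eq_mul, ← Finset.sum_add_distrib]
        simp [mul_add] }
  have hχ : ∀ x (e : E), χ x e = ψ (∑ i, x i * e.1 i) := fun _ _ => rfl
  have hχ0 : ∀ x, χ x = 0 ↔ ∀ e ∈ E, ψ (∑ i, x i * e i) = 1 := fun x => by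
    rw [DFunLike.ext_iff]
    simp only [hχ, AddChar.zero_apply, Subtype.forall]
  have hpow : (∑ s, γ s) ^ Fintype.card ι = ∑ x : ι → R, ∏ i, γ (x i) := by
    rw [← Fintype.prod_sum, Finset.prod_const, Finset.card_univ]
  rw [hpow, AddChar.sum_eq_sum_filter_trivial E _ χ (fun x e => by
    rw [hadd, hE1 e.1 e.2, hχ, mul_one])]
  have hconst : ∀ e ∈ E, ∀ t : R, ∑ i, (e i + t) = t := fun e he t => by
    rw [Finset.sum_add_distrib, hE0 e he]; simp [hι]
  have hcast : (Nat.card E : ℂ) * ∑ t, γ t ^ Fintype.card ι =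
      ∑ p : E × R, γ p.2 ^ Fintype.card ι := by
    rw [Fintype.sum_prod_type]
    simp
  rw [hcast]
  -- The words that survive the averaging are those of `E^⊥`, each uniquely `e + t j`; as `|ι| = 1`
  -- in `R` and `e` sums to zero, `t` is the coordinate sum.
  symm
  refine Finset.sum_bij' (fun p _ i => p.1.1 i + p.2)
    (fun x hx => (⟨fun i => x i - ∑ i, x i, hperp x ((hχ0 x).mp (Finset.mem_filter.mp hx).2)⟩,
      ∑ i, x i)) ?_ ?_ ?_ ?_ ?_
  · rintro ⟨⟨e, he⟩, t⟩ -
    refine Finset.mem_filter.mpr ⟨Finset.mem_univ _, (hχ0 _).mpr fun a ha => ?_⟩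
    have : ∑ i, (e i + t) * a i = ∑ i, e i * a i := by
      simp_rw [add_mul]
      rw [Finset.sum_add_distrib, ← Finset.mul_sum, hE0 a ha]; simp
    simp only [this]
    exact hEE e he a ha
  · intro x hx; exact Finset.mem_univ _
  · rintro ⟨⟨e, he⟩, t⟩ -
    simp only [hconst e he t, add_sub_cancel_right]
  · intro x hx
    ext i; simp
  · rintro ⟨⟨e, he⟩, t⟩ -
    have h1 := hadd e (fun _ => t)
    have h2 : ∑ i, e i * t = 0 := by rw [← Finset.sum_mul, hE0 e he, zero_mul]
    simp only [Pi.add_apply] at h1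
    rw [h1, hE1 e he, h2]
    simp

/-! ### Quadratic Gauss sums modulo an odd number -/

/-- The quadratic Gauss sum modulo `M`. -/
noncomputable def ZMod.quadraticGaussSum (M : ℕ) [NeZero M] : ℂ :=
  ∑ x : ZMod M, ZMod.stdAddChar (x ^ 2)

namespace ZMod

theorem star_stdAddChar (M : ℕ) [NeZero M] (x : ZMod M) :
    star (stdAddChar x) = stdAddChar (-x) := by
  rw [AddChar.map_neg_eq_conj]; rfl

/-- The squared absolute value is `M`: substituting `x = y + u` and summing over `y` first leaves
only `u = 0`, since 2 is a unit. -/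
theorem quadraticGaussSum_ne_zero (M : ℕ) [NeZero M] (hM : Odd M) : quadraticGaussSum M ≠ 0 := by
  intro h0
  have h2 : IsUnit (2 : ZMod M) := by
    have := (ZMod.isUnit_iff_coprime 2 M).mpr (Nat.coprime_two_left.mpr hM)
    exact_mod_cast this
  have h1 : quadraticGaussSum M * star (quadraticGaussSum M) = M := by
    unfold quadraticGaussSum
    rw [star_sum, Finset.sum_mul_sum, Finset.sum_comm]
    have e1 : ∀ y : ZMod M, ∑ x : ZMod M, stdAddChar (x ^ 2) * star (stdAddChar (y ^ 2)) =
        ∑ u : ZMod M, stdAddChar (u ^ 2) * stdAddChar (y * (2 * u)) := fun y => by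
      rw [← Equiv.sum_comp (Equiv.addRight y)]
      refine Finset.sum_congr rfl fun u _ => ?_
      rw [star_stdAddChar, ← AddChar.map_add_eq_mul, ← AddChar.map_add_eq_mul]
      congr 1
      simp; ring
    simp_rw [e1]
    rw [Finset.sum_comm]
    simp_rw [← Finset.mul_sum]
    simp_rw [AddChar.sum_mulShift _ (isPrimitive_stdAddChar M), h2.mul_right_eq_zero]
    simp [ZMod.card]
  rw [h0, zero_mul] at h1
  exact NeZero.ne M (by exact_mod_cast h1.symm)

/-- Write the sum as `∑ (χ u + 1) ψ u` with `χ` the quadratic character. Since `χ (-1) = -1`,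
conjugation negates the `χ` part, and the rest is a full character sum, which is zero. -/
theorem star_quadraticGaussSum_prime {p : ℕ} [Fact p.Prime] (hp : p % 4 = 3) :
    star (quadraticGaussSum p) = -quadraticGaussSum p := by
  have hp2 : ringChar (ZMod p) ≠ 2 := by rw [ZMod.ringChar_zmod_n]; rintro rfl; simp at hp
  have h1 : ∀ ψ : AddChar (ZMod p) ℂ, ∑ x : ZMod p, ψ (x ^ 2) =
      ∑ u : ZMod p, ((quadraticChar (ZMod p) u + 1 : ℤ) : ℂ) * ψ u := fun ψ => by
    rw [← Finset.sum_fiberwise (s := univ) (g := fun x : ZMod p => x ^ 2)]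
    refine Finset.sum_congr rfl fun u _ => ?_
    rw [Finset.sum_congr rfl (fun a ha => by rw [(Finset.mem_filter.mp ha).2]),
      Finset.sum_const, nsmul_eq_mul, ← quadraticChar_card_sqrts hp2 u]
    congr 2
    simp [Set.toFinset_ofPred]
  have hneg : quadraticChar (ZMod p) (-1) = -1 := by
    rw [quadraticChar_neg_one hp2, ZMod.card, ZMod.χ₄_nat_three_mod_four hp]
  have h2 : quadraticGaussSum p + star (quadraticGaussSum p) = 0 := by
    have e0 : star (quadraticGaussSum p) =
        ∑ x : ZMod p, (AddChar.mulShift stdAddChar (-1)) (x ^ 2) := by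
      unfold quadraticGaussSum
      rw [star_sum]
      refine Finset.sum_congr rfl fun x _ => ?_
      rw [star_stdAddChar, AddChar.mulShift_apply]; simp
    have e1 : star (quadraticGaussSum p) = ∑ u : ZMod p,
        ((-quadraticChar (ZMod p) u + 1 : ℤ) : ℂ) * (stdAddChar u : ℂ) := by
      rw [e0, h1, ← Equiv.sum_comp (Equiv.neg (ZMod p))]
      refine Finset.sum_congr rfl fun u _ => ?_
      rw [AddChar.mulShift_apply, Equiv.neg_apply, neg_one_mul, neg_neg, ← neg_one_mul u, map_mul,
        hneg]
      simp
    rw [e1, quadraticGaussSum, h1, ← Finset.sum_add_distrib]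
    have e2 : ∀ u : ZMod p, ((quadraticChar (ZMod p) u + 1 : ℤ) : ℂ) * stdAddChar u +
        ((-quadraticChar (ZMod p) u + 1 : ℤ) : ℂ) * stdAddChar u = 2 * stdAddChar u := fun u => by
      push_cast; ring
    simp_rw [e2]
    rw [← Finset.mul_sum, AddChar.sum_eq_zero_of_ne_one, mul_zero]
    intro h
    have := injective_stdAddChar (N := p) (a₁ := 1) (a₂ := 0) (by rw [h]; simp)
    exact one_ne_zero this
  linear_combination h2

/-- Translation by multiples of `p ^ (h + 1)`, whose squares vanish, restricts the sum to multiples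
of `p ^ h`. There `(p ^ h t)² / p ^ (2h + 1) = t² / p`, so the sum is a real multiple of the one
modulo `p`. -/
theorem star_quadraticGaussSum {p h : ℕ} [Fact p.Prime] (hp : p % 4 = 3) :
    star (quadraticGaussSum (p ^ (2 * h + 1))) = -quadraticGaussSum (p ^ (2 * h + 1)) := by
  classical
  have hpp : p.Prime := Fact.out
  set M := p ^ (2 * h + 1) with hM
  have hpodd : Odd p := by rw [Nat.odd_iff]; omega
  have h2 : IsUnit (2 : ZMod M) := by
    have := (ZMod.isUnit_iff_coprime 2 M).mpr (Nat.coprime_two_left.mpr hpodd.pow)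
    exact_mod_cast this
  have hM0 : (p : ZMod M) ^ (2 * h + 1) = 0 := by
    rw [← Nat.cast_pow, ← hM, ZMod.natCast_self]
  let E : AddSubgroup (ZMod M) := (AddMonoidHom.mulLeft ((p : ZMod M) ^ (h + 1))).range
  let K : AddSubgroup (ZMod M) := (AddMonoidHom.mulLeft ((p : ZMod M) ^ (h + 1))).ker
  let χ : ZMod M → AddChar E ℂ := fun x =>
    { toFun := fun e => stdAddChar (2 * x * e.1)
      map_zero_eq_one' := by simp
      map_add_eq_mul' := fun a b => by
        rw [← AddChar.map_add_eq_mul]; simp [mul_add] }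
  have hχ : ∀ x (e : E), χ x e = stdAddChar (2 * x * e.1) := fun _ _ => rfl
  have hχ0 : ∀ x, χ x = 0 ↔ x ∈ K := fun x => by
    rw [DFunLike.ext_iff]
    constructor
    · intro hx
      have h1 := hx ⟨(p : ZMod M) ^ (h + 1), ⟨1, by simp⟩⟩
      rw [hχ, AddChar.zero_apply, ← AddChar.map_zero_eq_one (stdAddChar (N := M))] at h1
      have h3 := injective_stdAddChar h1
      rw [mul_assoc] at h3
      rw [AddMonoidHom.mem_ker, AddMonoidHom.coe_mulLeft, mul_comm]
      exact h2.mul_right_eq_zero.mp h3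
    · rintro hx ⟨e, s, rfl⟩
      rw [AddMonoidHom.mem_ker, AddMonoidHom.coe_mulLeft] at hx
      rw [hχ, AddChar.zero_apply, ← AddChar.map_zero_eq_one (stdAddChar (N := M))]
      congr 1
      change 2 * x * ((p : ZMod M) ^ (h + 1) * s) = 0
      linear_combination 2 * s * hx
  have hG : quadraticGaussSum M = ∑ x : K, stdAddChar (x.1 ^ 2) := by
    unfold quadraticGaussSum
    rw [AddChar.sum_eq_sum_filter_trivial E _ χ]
    · simp only [hχ0]
      rw [← Finset.sum_subtype_eq_sum_filter]
      simp
    · rintro x ⟨e, s, rfl⟩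
      rw [hχ, ← AddChar.map_add_eq_mul]
      congr 1
      change (x + (p : ZMod M) ^ (h + 1) * s) ^ 2 = x ^ 2 + 2 * x * ((p : ZMod M) ^ (h + 1) * s)
      linear_combination (p : ZMod M) * s ^ 2 * hM0
  let φ : ZMod M →+ K := (AddMonoidHom.mulLeft ((p : ZMod M) ^ h)).codRestrict K (fun x => by
    rw [AddMonoidHom.mem_ker, AddMonoidHom.coe_mulLeft, AddMonoidHom.coe_mulLeft]
    linear_combination x * hM0)
  have hφv : ∀ x, (φ x).1 = (p : ZMod M) ^ h * x := fun _ => rfl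
  have hφ : Function.Surjective φ := by
    rintro ⟨x, hx⟩
    rw [AddMonoidHom.mem_ker, AddMonoidHom.coe_mulLeft] at hx
    have h3 : M ∣ p ^ (h + 1) * x.val := by
      rw [← ZMod.natCast_eq_zero_iff]
      push_cast
      rw [ZMod.natCast_zmod_val]; exact hx
    have h4 : p ^ h ∣ x.val := by
      have hM' : M = p ^ (h + 1) * p ^ h := by rw [hM, ← pow_add]; congr 1; ring
      replace h3 := hM'.symm.dvd.trans h3
      exact Nat.dvd_of_mul_dvd_mul_left (pow_pos hpp.pos _) h3
    obtain ⟨t, ht⟩ := h4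
    refine ⟨(t : ZMod M), Subtype.ext ?_⟩
    have h5 := congrArg (Nat.cast : ℕ → ZMod M) ht
    rw [ZMod.natCast_zmod_val] at h5
    rw [hφv, ← Nat.cast_pow, ← Nat.cast_mul, ← h5]
  have hpM : p ∣ M := dvd_pow_self p (by omega)
  let ρ : ZMod M →+* ZMod p := ZMod.castHom hpM (ZMod p)
  have hρ : Function.Surjective ρ.toAddMonoidHom := ZMod.castHom_surjective hpM
  obtain ⟨N, hN, hNs⟩ := φ.exists_sum_comp_eq hφ
  obtain ⟨N', -, hNs'⟩ := ρ.toAddMonoidHom.exists_sum_comp_eq hρ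
  have key : (N : ℂ) * quadraticGaussSum M = N' * quadraticGaussSum p := by
    rw [hG, ← hNs, quadraticGaussSum, ← hNs']
    refine Finset.sum_congr rfl fun t _ => ?_
    rw [hφv]
    obtain ⟨j, rfl⟩ := ZMod.intCast_surjective t
    have e1 : ρ.toAddMonoidHom (j : ZMod M) = (j : ZMod p) := map_intCast ρ j
    rw [e1, show ((p : ZMod M) ^ h * (j : ZMod M)) ^ 2 = (((p : ℤ) ^ (2 * h) * j ^ 2 : ℤ) : ZMod M)
      by push_cast; ring, show (j : ZMod p) ^ 2 = ((j ^ 2 : ℤ) : ZMod p) by push_cast; rfl,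
      stdAddChar_coe, stdAddChar_coe, hM]
    congr 1
    have : (p : ℂ) ≠ 0 := Nat.cast_ne_zero.mpr hpp.ne_zero
    push_cast
    field_simp
    ring
  have hN' : (N : ℂ) ≠ 0 := Nat.cast_ne_zero.mpr hN
  apply mul_left_cancel₀ hN'
  have := congrArg star key
  rw [star_mul', star_mul', star_quadraticGaussSum_prime hp, star_natCast, star_natCast] at this
  rw [this, mul_neg, mul_neg, key]

end ZMod

/-! ### Codes of a tight coclique and the sign contradictions -/

namespace SimpleGraph

/-- The code over `R` orthogonal to the all-ones vector and to the rows of `a` outside `Y`. -/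
def orthogonalCode {V : Type*} (a : V → V → ℤ) (Y : Finset V) (R : Type*) [CommRing R] :
    AddSubgroup (Y → R) where
  carrier := {x | ∑ y, x y = 0 ∧ ∀ z ∉ Y, ∑ y : Y, (a z y : R) * x y = 0}
  zero_mem' := by simp
  add_mem' := by
    rintro x x' ⟨hx, hxz⟩ ⟨hx', hxz'⟩
    refine ⟨by simp [-Finset.univ_eq_attach, Finset.sum_add_distrib, hx, hx'], fun z hz => ?_⟩
    simp [-Finset.univ_eq_attach, mul_add, Finset.sum_add_distrib, hxz z hz, hxz' z hz]
  neg_mem' := by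
    rintro x ⟨hx, hxz⟩
    exact ⟨by simp [-Finset.univ_eq_attach, hx],
      fun z hz => by simp [-Finset.univ_eq_attach, hxz z hz]⟩

theorem mem_orthogonalCode {V : Type*} {a : V → V → ℤ} {Y : Finset V} {R : Type*} [CommRing R]
    {x : Y → R} : x ∈ orthogonalCode a Y R ↔
      ∑ y, x y = 0 ∧ ∀ z ∉ Y, ∑ y : Y, (a z y : R) * x y = 0 := Iff.rfl

/-- The indicator of the relation between a vertex and its non-neighbours. -/
def nonAdj {V : Type*} (G : SimpleGraph V) [DecidableRel G.Adj] (u w : V) : ℤ := if G.Adj u w then 0 else 1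

theorem seidelSign_eq_nonAdj {V : Type*} (G : SimpleGraph V) [DecidableRel G.Adj] (u w : V) : G.seidelSign u w = 2 * G.nonAdj u w - 1 := by
  unfold seidelSign nonAdj; split_ifs <;> rfl

namespace IsTightCoclique

variable {V : Type*} [DecidableEq V] [Fintype V] {G : SimpleGraph V} [DecidableRel G.Adj]
  {q : ℤ} {Y : Finset V}

/-- The columns indexed by `Y` have Gram matrix `J + (q - 1)(q² + 1)I`. -/
theorem sum_mul_sum (hY : G.IsTightCoclique q Y) (x x' : Y → ℤ) :
    ∑ z ∈ Yᶜ, (∑ y : Y, G.seidelSign z y * x y) * (∑ y : Y, G.seidelSign z y * x' y) =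
      (∑ y, x y) * (∑ y, x' y) + (q - 1) * (q ^ 2 + 1) * ∑ y, x y * x' y := by
  have h1 : ∀ z, (∑ y : Y, G.seidelSign z y * x y) * (∑ y : Y, G.seidelSign z y * x' y) =
      ∑ y : Y, ∑ w : Y, x y * x' w * (G.seidelSign z y * G.seidelSign z w) := fun z => by
    rw [Finset.sum_mul_sum]
    exact Finset.sum_congr rfl fun y _ => Finset.sum_congr rfl fun w _ => by ring
  simp_rw [h1]
  rw [Finset.sum_comm]
  have h2 : ∀ y : Y, ∑ z ∈ Yᶜ, ∑ w : Y, x y * x' w * (G.seidelSign z y * G.seidelSign z w) =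
      ∑ w : Y, (x y * x' w + if y = w then (q - 1) * (q ^ 2 + 1) * (x y * x' w) else 0) := by
    intro y
    rw [Finset.sum_comm]
    refine Finset.sum_congr rfl fun w _ => ?_
    rw [← Finset.mul_sum, hY.sum_col_mul y y.2 w w.2]
    simp only [Subtype.ext_iff]
    split_ifs <;> ring
  simp_rw [h2, Finset.sum_add_distrib]
  rw [Finset.sum_mul_sum, Finset.mul_sum]
  simp

theorem sum_sum (hY : G.IsTightCoclique q Y) (x : Y → ℤ) :
    ∑ z ∈ Yᶜ, ∑ y : Y, G.seidelSign z y * x y = -q ^ 2 * ∑ y, x y := by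
  rw [Finset.sum_comm, Finset.mul_sum]
  refine Finset.sum_congr rfl fun y _ => ?_
  rw [← Finset.sum_mul, hY.sum_col y y.2]

theorem sum_row' (hY : G.IsTightCoclique q Y) {z : V} (hz : z ∉ Y) :
    ∑ y : Y, G.seidelSign z y = -q := by
  rw [Finset.sum_coe_sort Y (fun y => G.seidelSign z y), hY.sum_row z hz]

theorem sum_row_mul' (hY : G.IsTightCoclique q Y) {z w : V} (hz : z ∉ Y) (hw : w ∉ Y) :
    ∑ y : Y, G.seidelSign z y * G.seidelSign w y =
      1 + (q - 1) * (if z = w then q else G.seidelSign z w) := by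
  rw [Finset.sum_coe_sort Y (fun y => G.seidelSign z y * G.seidelSign w y)]
  split_ifs with h
  · subst h
    simp only [seidelSign_mul_self, Finset.sum_const, nsmul_eq_mul, mul_one, hY.card_eq]
    ring
  · exact hY.sum_row_mul z hz w hw h

/-- For an integer lift of `x`, every product in `sum_mul_sum` is divisible by `M²`. The factor `q -
1` accounts for only one `M`, so the other divides `∑ x²`. -/
theorem sum_sq_eq_zero_of_mem_signCode (hY : G.IsTightCoclique q Y) {M : ℕ} {c : ℤ}
    (hM : M ≠ 0) (hqM : q - 1 = M * c) (hc : IsCoprime (M : ℤ) (c * (q ^ 2 + 1)))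
    {x : Y → ZMod M} (hx : x ∈ orthogonalCode G.seidelSign Y (ZMod M)) : ∑ y, x y ^ 2 = 0 := by
  obtain ⟨hx0, hxz⟩ := mem_orthogonalCode.mp hx
  choose X hX using fun y => ZMod.intCast_surjective (x y)
  have h0 : (M : ℤ) ∣ ∑ y, X y := by
    rw [← ZMod.intCast_zmod_eq_zero_iff_dvd]; push_cast; simpa [hX] using hx0
  have hz : ∀ z ∈ Yᶜ, (M : ℤ) ∣ ∑ y : Y, G.seidelSign z y * X y := fun z hz => by
    rw [← ZMod.intCast_zmod_eq_zero_iff_dvd]; push_cast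
    simpa [hX] using hxz z (by simpa using hz)
  have h1 : (M : ℤ) * M ∣ (q - 1) * (q ^ 2 + 1) * ∑ y, X y * X y := by
    rw [← (Int.dvd_add_right (mul_dvd_mul h0 h0)), ← hY.sum_mul_sum X X]
    exact Finset.dvd_sum fun z hz' => mul_dvd_mul (hz z hz') (hz z hz')
  rw [hqM, mul_assoc, mul_assoc] at h1
  have h2 := Int.dvd_of_mul_dvd_mul_left (by exact_mod_cast hM) h1
  rw [← mul_assoc] at h2
  have h3 := (ZMod.intCast_zmod_eq_zero_iff_dvd _ _).mpr (hc.dvd_of_dvd_mul_left h2)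
  push_cast at h3
  simpa [hX, pow_two] using h3

/-- Modulo `M`, rows outside `Y` have sum `-1` and mutual inner products `1`, and `|Y| = 1`. So each
row plus `j` is a codeword, and orthogonality to these words suffices. -/
theorem sub_sum_mem_signCode (hY : G.IsTightCoclique q Y) {M : ℕ} (hqM : (q : ZMod M) = 1)
    {x : Y → ZMod M} (hx : ∀ e ∈ orthogonalCode G.seidelSign Y (ZMod M), ∑ y, x y * e y = 0) :
    (fun y => x y - ∑ y, x y) ∈ orthogonalCode G.seidelSign Y (ZMod M) := by
  have hcard : ((Y.card : ℤ) : ZMod M) = 1 := by rw [hY.card_eq]; push_cast; rw [hqM]; ring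
  have hcard' : (Y.card : ZMod M) = 1 := by exact_mod_cast hcard
  have hrow : ∀ z ∉ Y, ∑ y : Y, (G.seidelSign z y : ZMod M) = -1 := fun z hz => by
    have := congrArg (Int.cast : ℤ → ZMod M) (hY.sum_row' hz)
    push_cast at this; rw [this, hqM]
  have hd : ∀ z ∉ Y, (fun y : Y => (G.seidelSign z y : ZMod M) + 1) ∈ orthogonalCode G.seidelSign Y (ZMod M) := by
    intro z hz
    refine mem_orthogonalCode.mpr ⟨?_, fun w hw => ?_⟩
    · rw [Finset.sum_add_distrib, hrow z hz]; simp [hcard']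
    · have h1 := congrArg (Int.cast : ℤ → ZMod M) (hY.sum_row_mul' hw hz)
      push_cast at h1
      simp_rw [mul_add]
      rw [Finset.sum_add_distrib, h1, hqM]
      simp [-Finset.univ_eq_attach, hrow w hw]
  refine mem_orthogonalCode.mpr ⟨?_, fun z hz => ?_⟩
  · rw [Finset.sum_sub_distrib]; simp [hcard']
  · have h1 := hx _ (hd z hz)
    simp_rw [mul_add, mul_one] at h1
    rw [Finset.sum_add_distrib] at h1
    simp_rw [mul_sub]
    rw [Finset.sum_sub_distrib, ← Finset.sum_mul, hrow z hz]
    simp_rw [mul_comm (G.seidelSign z _ : ZMod M)]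
    linear_combination h1

theorem gaussSum_pow (hY : G.IsTightCoclique q Y) {M : ℕ} [NeZero M] {c : ℤ} (hM : Odd M)
    (hqM : q - 1 = M * c) (hc : IsCoprime (M : ℤ) (c * (q ^ 2 + 1))) :
    ZMod.quadraticGaussSum M ^ Y.card = Nat.card (orthogonalCode G.seidelSign Y (ZMod M)) * ZMod.quadraticGaussSum M := by
  have h2 : IsUnit (2 : ZMod M) := by
    have := (ZMod.isUnit_iff_coprime 2 M).mpr (Nat.coprime_two_left.mpr hM)
    exact_mod_cast this
  have hq1 : (q : ZMod M) = 1 := by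
    have := congrArg (Int.cast : ℤ → ZMod M) hqM
    push_cast at this
    rw [ZMod.natCast_self, zero_mul] at this
    linear_combination this
  have hcard : ((Y.card : ℤ) : ZMod M) = 1 := by rw [hY.card_eq]; push_cast; rw [hq1]; ring
  have hcard' : (Y.card : ZMod M) = 1 := by exact_mod_cast hcard
  have key := AddChar.gauss_pow_eq_card_mul (R := ZMod M) (ι := Y) (by simpa using hcard')
    (fun s => ZMod.stdAddChar (s ^ 2)) (AddChar.mulShift ZMod.stdAddChar 2)
    (fun s t => by
      rw [AddChar.mulShift_apply, ← AddChar.map_add_eq_mul, ← AddChar.map_add_eq_mul]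
      congr 1; ring)
    (orthogonalCode G.seidelSign Y (ZMod M)) (fun e he => (mem_orthogonalCode.mp he).1)
    (fun e he => by
      rw [← AddChar.map_sum_eq_prod_apply,
        hY.sum_sq_eq_zero_of_mem_signCode (NeZero.ne M) hqM hc he, AddChar.map_zero_eq_one])
    (fun x hx => hY.sub_sum_mem_signCode hq1 fun e he => by
      have h1 := hx e he
      rw [AddChar.mulShift_apply, ← AddChar.map_zero_eq_one (ZMod.stdAddChar (N := M))] at h1
      exact h2.mul_right_eq_zero.mp (ZMod.injective_stdAddChar h1))
  rw [Fintype.card_coe] at key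
  -- Since `|Y| ≡ 1` modulo `M`, the right-hand sum is again the Gauss sum.
  have h3 : ∀ t : ZMod M, ZMod.stdAddChar (t ^ 2) ^ Y.card = ZMod.stdAddChar (t ^ 2) := fun t => by
    rw [← AddChar.map_nsmul_eq_pow, nsmul_eq_mul, hcard', one_mul]
  simp_rw [h3] at key
  exact key

theorem false_of_prime_pow (hY : G.IsTightCoclique q Y) {p h : ℕ} {l : ℤ} (hp : p.Prime)
    (hp4 : p % 4 = 3) (hl : Odd l) (hlp : IsCoprime l p)
    (hq : q - 1 = p ^ (2 * h + 1) * (2 * l)) : False := by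
  have : Fact p.Prime := ⟨hp⟩
  have hpodd : Odd p := by rw [Nat.odd_iff]; omega
  have hp2 : IsCoprime (2 : ℤ) p := by
    have := Nat.isCoprime_iff_coprime.mpr (Nat.coprime_two_left.mpr hpodd)
    exact_mod_cast this
  -- `q² + 1 ≡ 2` modulo `p`.
  have hpq : IsCoprime (p : ℤ) (q ^ 2 + 1) := by
    have : q ^ 2 + 1 = 2 + p * (p ^ (2 * h) * (2 * l) * (q + 1)) := by
      have : q ^ 2 + 1 = 2 + (q - 1) * (q + 1) := by ring
      rw [this, hq]; ring
    rw [this]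
    exact IsCoprime.add_mul_left_right_iff.mpr hp2.symm
  set M := p ^ (2 * h + 1) with hM
  have : NeZero M := ⟨pow_ne_zero _ hp.ne_zero⟩
  have hMcop : IsCoprime (M : ℤ) (2 * l * (q ^ 2 + 1)) := by
    rw [hM]; push_cast
    exact ((hp2.symm.mul_right hlp.symm).mul_right hpq).pow_left
  have key := hY.gaussSum_pow (M := M) hpodd.pow (by rw [hq, hM]; push_cast; rfl) hMcop
  have hstar : star (ZMod.quadraticGaussSum M) = -ZMod.quadraticGaussSum M :=
    ZMod.star_quadraticGaussSum hp4
  have hne := ZMod.quadraticGaussSum_ne_zero M hpodd.pow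
  set g := ZMod.quadraticGaussSum M with hg
  have hodd : Odd (q * (p ^ (2 * h + 1) * l)) := by
    have h1 : Odd ((p : ℤ) ^ (2 * h + 1)) := by exact_mod_cast hpodd.pow
    refine Odd.mul ?_ (h1.mul hl)
    rw [show q = 2 * (p ^ (2 * h + 1) * l) + 1 by linear_combination hq]
    exact odd_two_mul_add_one _
  have hcard : (Y.card : ℤ) = 2 * (q * (p ^ (2 * h + 1) * l)) + 1 := by
    rw [hY.card_eq]; linear_combination q * hq
  obtain ⟨r, hr⟩ := hodd
  have hcardn : Y.card = 2 * (2 * (r.toNat) + 1) + 1 := by omega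
  rw [hcardn, pow_succ] at key
  have key2 := mul_right_cancel₀ hne key
  have hg2 : g ^ 2 = -((Complex.normSq g : ℝ) : ℂ) := by
    rw [Complex.normSq_eq_conj_mul_self]
    change g ^ 2 = -(star g * g)
    rw [hstar]; ring
  rw [pow_mul, hg2, Odd.neg_pow (odd_two_mul_add_one _)] at key2
  have h5 : -(Complex.normSq g) ^ (2 * r.toNat + 1) = (Nat.card (orthogonalCode G.seidelSign Y (ZMod M)) : ℝ) := by
    exact_mod_cast key2
  have h6 : 0 < Complex.normSq g ^ (2 * r.toNat + 1) := pow_pos (Complex.normSq_pos.mpr hne) _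
  have h7 : (0 : ℝ) ≤ Nat.card (orthogonalCode G.seidelSign Y (ZMod M)) := Nat.cast_nonneg _
  linarith

/-- Signs are trivial modulo 2, hence the 0/1 matrix. Lift `x` to a 0/1 vector of weight `2t`, with
even row products `2s`. The first and second moments determine `∑ s` and `∑ s²`; comparing them
through `s² ≡ s` modulo 2 makes `t` even, because `(q - 1)(q² + 1)/8` is odd. -/
theorem four_dvd_weight (hY : G.IsTightCoclique q Y) {b : ℤ} (hq : q = 8 * b + 5)
    {x : Y → ZMod 2} (hx : x ∈ orthogonalCode G.nonAdj Y (ZMod 2)) : 4 ∣ ∑ y, (x y).val := by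
  obtain ⟨hx0, hxz⟩ := mem_orthogonalCode.mp hx
  let X : Y → ℤ := fun y => (x y).val
  have hX : ∀ y, ((X y : ℤ) : ZMod 2) = x y := fun y => by simp [X]
  have hXX : ∀ y, X y * X y = X y := fun y => by
    have : (x y).val < 2 := ZMod.val_lt _
    simp only [X]
    interval_cases (x y).val <;> rfl
  have h0 : (2 : ℤ) ∣ ∑ y, X y := by
    rw [← Nat.cast_two, ← ZMod.intCast_zmod_eq_zero_iff_dvd]; push_cast; simpa [hX] using hx0
  have hz : ∀ z, ∃ s, z ∈ Yᶜ → ∑ y : Y, G.nonAdj z y * X y = 2 * s := fun z => by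
    by_cases hz : z ∈ Yᶜ
    · have : (2 : ℤ) ∣ ∑ y : Y, G.nonAdj z y * X y := by
        rw [← Nat.cast_two, ← ZMod.intCast_zmod_eq_zero_iff_dvd]; push_cast
        simpa [hX] using hxz z (by simpa using hz)
      obtain ⟨s, hs⟩ := this
      exact ⟨s, fun _ => hs⟩
    · exact ⟨0, fun h => absurd h hz⟩
  choose s hs using hz
  obtain ⟨t, ht⟩ := h0
  have hsz : ∀ z ∈ Yᶜ, ∑ y : Y, G.seidelSign z y * X y = 4 * s z - 2 * t := fun z hz => by
    simp_rw [seidelSign_eq_nonAdj, sub_mul, mul_assoc, one_mul]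
    rw [Finset.sum_sub_distrib, ← Finset.mul_sum, hs z hz, ht]; ring
  have e1 := hY.sum_sum X
  rw [Finset.sum_congr rfl hsz, Finset.sum_sub_distrib, ← Finset.mul_sum, Finset.sum_const,
    nsmul_eq_mul, hY.card_compl, ht] at e1
  have e2 := hY.sum_mul_sum X X
  rw [Finset.sum_congr rfl (fun z hz => by
      rw [hsz z hz, show (4 * s z - 2 * t) * (4 * s z - 2 * t) =
        16 * (s z * s z) - 16 * t * s z + 4 * t ^ 2 by ring])] at e2
  simp_rw [hXX] at e2
  rw [Finset.sum_add_distrib, Finset.sum_sub_distrib, ← Finset.mul_sum, ← Finset.mul_sum,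
    Finset.sum_const, nsmul_eq_mul, hY.card_compl, ht] at e2
  have e3 : (2 : ℤ) ∣ ∑ z ∈ Yᶜ, s z * s z - ∑ z ∈ Yᶜ, s z := by
    rw [← Finset.sum_sub_distrib]
    refine Finset.dvd_sum fun z _ => ?_
    rw [show s z * s z - s z = (s z - 1) * (s z - 1 + 1) by ring]
    exact (Int.even_mul_succ_self _).two_dvd
  obtain ⟨w, hw⟩ := e3
  have e4 : ∑ z ∈ Yᶜ, s z = 8 * t * q * (2 * b + 1) ^ 2 := by
    subst hq
    apply mul_left_cancel₀ (four_ne_zero (α := ℤ))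
    linear_combination e1
  have e5 : (2 * b + 1) * (32 * b ^ 2 + 40 * b + 13) * t = 2 * (w + 4 * t * q * (2 * b + 1) ^ 2 -
      4 * t ^ 2 * q * (2 * b + 1) ^ 2 + (2 * b + 1) * (32 * b ^ 2 + 40 * b + 13) * t ^ 2) := by
    have e6 : ∑ z ∈ Yᶜ, s z * s z = 2 * w + 8 * t * q * (2 * b + 1) ^ 2 := by
      rw [← e4]; linear_combination hw
    rw [e6, e4] at e2
    subst hq
    apply mul_left_cancel₀ (show (16 : ℤ) ≠ 0 by norm_num)
    linear_combination -e2
  have hodd : Odd ((2 * b + 1) * (32 * b ^ 2 + 40 * b + 13)) :=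
    (odd_two_mul_add_one b).mul ⟨16 * b ^ 2 + 20 * b + 6, by ring⟩
  have ht2 : Even t := by
    have h1 := (Int.even_mul.mp (e5 ▸ even_two_mul _))
    exact h1.resolve_left (Int.not_even_iff_odd.mpr hodd)
  obtain ⟨r, hr⟩ := ht2
  have h8 : ((∑ y, (x y).val : ℕ) : ℤ) = 4 * r := by
    push_cast
    change ∑ y, X y = _
    rw [ht, hr]; ring
  exact Int.natCast_dvd_natCast.mp ⟨r, by exact_mod_cast h8⟩

/-- Rows outside `Y` have even weight `(q - 1)²/2` and meet evenly, so they are codewords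
themselves. -/
theorem sub_sum_mem_blockCode (hY : G.IsTightCoclique q Y) {b : ℤ} (hq : q = 8 * b + 5)
    {x : Y → ZMod 2} (hx : ∀ e ∈ orthogonalCode G.nonAdj Y (ZMod 2), ∑ y, x y * e y = 0) :
    (fun y => x y - ∑ y, x y) ∈ orthogonalCode G.nonAdj Y (ZMod 2) := by
  have hcard : ((Y.card : ℤ) : ZMod 2) = 1 := by
    rw [hY.card_eq, show q ^ 2 - q + 1 = 2 * (32 * b ^ 2 + 36 * b + 10) + 1 by subst hq; ring]
    push_cast
    rw [show (2 : ZMod 2) = 0 from rfl]; ring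
  have hcard' : (Y.card : ZMod 2) = 1 := by exact_mod_cast hcard
  have hrowZ : ∀ z ∉ Y, ∑ y : Y, G.nonAdj z y = 2 * (4 * (2 * b + 1) ^ 2) := fun z hz => by
    have h1 := hY.sum_row' hz
    simp_rw [seidelSign_eq_nonAdj] at h1
    rw [Finset.sum_sub_distrib, ← Finset.mul_sum] at h1
    simp only [Finset.sum_const, Finset.card_univ, Fintype.card_coe, nsmul_eq_mul, hY.card_eq]
      at h1
    apply mul_left_cancel₀ (two_ne_zero (α := ℤ))
    subst hq; linear_combination h1
  have hrow : ∀ z ∉ Y, ∑ y : Y, (G.nonAdj z y : ZMod 2) = 0 := fun z hz => by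
    have h1 := congrArg (Int.cast : ℤ → ZMod 2) (hrowZ z hz)
    rw [Int.cast_mul, show ((2 : ℤ) : ZMod 2) = 0 from rfl, zero_mul] at h1
    exact_mod_cast h1
  have hd : ∀ z ∉ Y, (fun y : Y => (G.nonAdj z y : ZMod 2)) ∈ orthogonalCode G.nonAdj Y (ZMod 2) := by
    intro z hz
    refine mem_orthogonalCode.mpr ⟨hrow z hz, fun w hw => ?_⟩
    have h1 := hY.sum_row_mul' hw hz
    have h2 : ∀ y, G.seidelSign w y * G.seidelSign z y = 4 * (G.nonAdj w y * G.nonAdj z y) -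
        2 * G.nonAdj w y - 2 * G.nonAdj z y + 1 := fun y => by
      simp_rw [seidelSign_eq_nonAdj]; ring
    simp_rw [h2] at h1
    rw [Finset.sum_add_distrib, Finset.sum_sub_distrib, Finset.sum_sub_distrib, ← Finset.mul_sum,
      ← Finset.mul_sum, ← Finset.mul_sum, hrowZ z hz, hrowZ w hw] at h1
    simp only [Finset.sum_const, Finset.card_univ, Fintype.card_coe, nsmul_eq_mul, hY.card_eq]
      at h1
    -- Only oddness of this term matters, which treats `w = z` and `w ≠ z` together.
    have h3 : ∃ a : ℤ, (if w = z then q else G.seidelSign w z) = 2 * a + 1 := by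
      split_ifs
      · exact ⟨4 * b + 2, by subst hq; ring⟩
      · exact ⟨G.nonAdj w z - 1, by rw [seidelSign_eq_nonAdj]; ring⟩
    obtain ⟨a, ha⟩ := h3
    rw [ha] at h1
    have h4 : ∑ y : Y, G.nonAdj w y * G.nonAdj z y = 2 * ((2 * b + 1) * (4 * b + a + 2)) := by
      apply mul_left_cancel₀ (four_ne_zero (α := ℤ))
      subst hq; linear_combination h1
    have h5 := congrArg (Int.cast : ℤ → ZMod 2) h4
    rw [Int.cast_mul, show ((2 : ℤ) : ZMod 2) = 0 from rfl, zero_mul] at h5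
    exact_mod_cast h5
  refine mem_orthogonalCode.mpr ⟨?_, fun z hz => ?_⟩
  · rw [Finset.sum_sub_distrib]; simp [hcard']
  · have h1 := hx _ (hd z hz)
    simp_rw [mul_sub]
    rw [Finset.sum_sub_distrib, ← Finset.sum_mul, hrow z hz]
    simp_rw [mul_comm (G.nonAdj z _ : ZMod 2)]
    rw [h1]; ring

/-- Take `γ s = i ^ s`, whose polar form is `(-1) ^ (st)`. As `|Y| ≡ 5` modulo 8, `γ ^ |Y| = γ` and
`(1 + i) ^ (|Y| - 1)` is an odd power of `-4`. -/
theorem false_of_mod_eight (hY : G.IsTightCoclique q Y) {b : ℤ} (hq : q = 8 * b + 5) :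
    False := by
  have hcard : (Y.card : ℤ) = 8 * (8 * b ^ 2 + 9 * b + 2) + 5 := by
    rw [hY.card_eq]; subst hq; ring
  generalize 8 * b ^ 2 + 9 * b + 2 = d at hcard
  have hcardn : Y.card = 4 * (2 * d.toNat + 1) + 1 := by omega
  have hcard' : (Y.card : ZMod 2) = 1 := by
    rw [hcardn]; push_cast
    rw [show (4 : ZMod 2) = 0 from rfl]; ring
  have hneg : ((-1 : ℂ)) ^ 2 = 1 := by norm_num
  have hψ : ∀ u : ZMod 2, AddChar.zmodChar 2 hneg u = (-1) ^ u.val :=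
    fun u => AddChar.zmodChar_apply hneg u
  have hcases : ∀ u : ZMod 2, u = 0 ∨ u = 1 := by decide
  have key := AddChar.gauss_pow_eq_card_mul (R := ZMod 2) (ι := Y) (by simpa using hcard')
    (fun s => Complex.I ^ s.val) (AddChar.zmodChar 2 hneg)
    (fun s t => by
      rw [hψ]
      rcases hcases s with rfl | rfl <;> rcases hcases t with rfl | rfl
      · simp
      · simp
      · simp
      · rw [show (1 + 1 : ZMod 2) = 0 from rfl]; simp [ZMod.val_one])
    (orthogonalCode G.nonAdj Y (ZMod 2)) (fun e he => (mem_orthogonalCode.mp he).1)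
    (fun e he => by
      obtain ⟨r, hr⟩ := hY.four_dvd_weight hq he
      rw [Finset.prod_pow_eq_pow_sum, hr, pow_mul, Complex.I_pow_four, one_pow])
    (fun x hx => hY.sub_sum_mem_blockCode hq fun e he => by
      have h1 := hx e he
      rw [hψ] at h1
      rcases hcases (∑ y, x y * e y) with h | h
      · exact h
      · rw [h, ZMod.val_one] at h1; norm_num at h1)
  rw [Fintype.card_coe] at key
  have h2 : ∀ f : ZMod 2 → ℂ, ∑ s, f s = f 0 + f 1 := fun f => Fin.sum_univ_two f
  have h4 : (1 + Complex.I) ^ 4 = -4 := by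
    have := Complex.I_sq
    linear_combination (Complex.I ^ 2 + 4 * Complex.I + 5) * this
  have hne : 1 + Complex.I ≠ 0 := by
    intro h; rw [h] at h4; norm_num at h4
  rw [h2, h2, hcardn] at key
  simp only [ZMod.val_zero, ZMod.val_one, pow_zero, pow_one, one_pow] at key
  rw [pow_succ, pow_succ Complex.I, pow_mul Complex.I, Complex.I_pow_four, one_pow, one_mul] at key
  have key2 := mul_right_cancel₀ hne key
  rw [pow_mul, h4, Odd.neg_pow (odd_two_mul_add_one _)] at key2
  have h5 : -(4 : ℝ) ^ (2 * d.toNat + 1) = (Nat.card (orthogonalCode G.nonAdj Y (ZMod 2)) : ℝ) := by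
    exact_mod_cast key2
  have h6 : (0 : ℝ) < 4 ^ (2 * d.toNat + 1) := by positivity
  have h7 : (0 : ℝ) ≤ Nat.card (orthogonalCode G.nonAdj Y (ZMod 2)) := Nat.cast_nonneg _
  linarith

end IsTightCoclique

end SimpleGraph

end

/-! ### The main theorem -/

theorem mainTheorem4 {V : Type*} [Fintype V] [DecidableEq V] (G : SimpleGraph V)
    [DecidableRel G.Adj] (q : ℕ) (hq : 1 < q) (hodd : Odd q)
    (v k l m : ℕ) (ePos eNeg : ℝ)
    (hG : G.IsSRGWithEigenvalues v k l m ePos eNeg)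
    (hv : (v : ℝ) = ((q : ℝ) + 1) * ((q : ℝ) ^ 2 - (q : ℝ) + 1))
    (hePos : ePos = ((q : ℝ) - 1) / 2)
    (heNeg : eNeg = -(((q : ℝ) ^ 2 + 1) / 2)) :
    ((q ≡ 5 [MOD 8] ∨
        ∃ p e ℓ : ℕ, p.Prime ∧ p ≡ 3 [MOD 4] ∧ Odd e ∧ Odd ℓ ∧ Nat.gcd ℓ p = 1 ∧
          q = 2 * ℓ * p ^ e + 1) →
      ¬ ∃ Y : Finset V, G.IsDelsarteCoclique v k eNeg Y) ∧
    (3 < q → {Y : Finset V | G.IsDelsarteCoclique v k eNeg Y}.encard ≤ 2) := by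
  have hq' : (1 : ℤ) < q := by exact_mod_cast hq
  refine ⟨?_, fun h3 => ?_⟩
  · rintro h ⟨Y, hY⟩
    have hT := hG.isTightCoclique hq hv hePos heNeg hY
    rcases h with h | ⟨p, e, l, hp, hp4, he, hl, hlp, hqp⟩
    · have h1 : q % 8 = 5 := h
      exact hT.false_of_mod_eight (b := (q / 8 : ℕ)) (by omega)
    · obtain ⟨h, rfl⟩ := he
      refine hT.false_of_prime_pow (h := h) (l := l) hp hp4 (by exact_mod_cast hl)
        (Nat.isCoprime_iff_coprime.mpr hlp) ?_
      rw [hqp]; push_cast; ring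
  · refine le_trans (Set.encard_le_one_iff.mpr fun Y Y' hY hY' => ?_) one_le_two
    exact (hG.isTightCoclique hq hv hePos heNeg hY).eq_of_three_lt (by exact_mod_cast h3)
      (hG.isTightCoclique hq hv hePos heNeg hY')
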